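/- Identify strings in $\{0,1\}^n$ with subsets of $[n]$, and let $x\cup y$ be the coordinatewise OR. A function $f:\{0,1\}^n\to\{0,1\}$ is union-closed if $f(x)=f(y)=1$ implies $f(x\cup y)=1$. It is $\varepsilon$-far from union-closed if $\Pr_{x}[f(x)\ne g(x)]\ge\varepsilon$ for every union-closed $g:\{0,1\}^n\to\{0,1\}$, where $x$ is uniform in $\{0,1\}^n$. A $q$-query non-adaptive (two-sided error) $\varepsilon$-tester with success probability $p$ is a randomized algorithm that, given query access to an unknown $f:\{0,1\}^n\to\{0,1\}$, chooses $q$ query points without seeing any answers, outputs "yes" or "no" depending on its randomness and the $q$ answers, outputs "yes" with probability at least $p$ whenever $f$ is union-closed, and outputs "no" with probability at least $p$ whenever $f$ is $\varepsilon$-far from union-closed. Theorem. For every fixed success probability $p>1/2$ (for instance $p=2/3$) there are constants $c>0$ and $\kappa>0$, depending only on $p$, such that for every $n$ and every $\varepsilon$ with $c>\varepsilon\ge 2^{-n^{0.49}}$, every $q$-query non-adaptive $\varepsilon$-tester with success probability $p$ satisfies $$q\;\ge\; n^{\kappa\log_2(1/\varepsilon)}.$$ That is, $n^{\Omega(\log(1/\varepsilon))}$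 queries are necessary. -/

import Mathlib

/-- Bit strings of length `n`, viewed also as subsets of an `n`-element set. -/
abbrev Cube (n : ℕ) : Type := Fin n → Bool

/-- The union of two strings: the coordinatewise OR. -/
def Cube.union {n : ℕ} (x y : Cube n) : Cube n := fun i => x i || y i

/-- `f` is union-closed: its set of satisfying assignments is a union-closed family of sets. -/
def UnionClosed {n : ℕ} (f : Cube n → Bool) : Prop :=
  ∀ x y : Cube n, f x = true → f y = true → f (x.union y) = true

/-- Normalized Hamming distance: the fraction of the `2 ^ n` inputs on which `f` and `g` differ. -/
noncomputable def boolDist {n : ℕ} (f g : Cube n → Bool) : ℝ :=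
  (hammingDist f g : ℝ) / 2 ^ n

/-- `f` is `ε`-far from the property `P`: every member of `P` is at distance at least `ε`. -/
def FarFrom {n : ℕ} (ε : ℝ) (P : (Cube n → Bool) → Prop) (f : Cube n → Bool) : Prop :=
  ∀ g : Cube n → Bool, P g → ε ≤ boolDist f g

/-- A deterministic non-adaptive algorithm with `q` queries: the query points are fixed in advance
(they may repeat), and the output is an arbitrary function of the `q` answers. -/
structure NonAdaptiveAlg (n q : ℕ) where
  query : Fin q → Cube n
  verdict : (Fin q → Bool) → Bool

/-- The output on input function `f`: `true` is "yes" (accept), `false` is "no" (reject). -/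
def NonAdaptiveAlg.output {n q : ℕ} (A : NonAdaptiveAlg n q) (f : Cube n → Bool) : Bool :=
  A.verdict fun i => f (A.query i)

/-- Probability that a randomized non-adaptive algorithm, that is, a probability distribution over
deterministic ones, outputs `b` on input function `f`. -/
noncomputable def outputProb {n q : ℕ} (T : PMF (NonAdaptiveAlg n q)) (f : Cube n → Bool)
    (b : Bool) : ℝ :=
  ((T.map fun A => A.output f) b).toReal

/-- `T` is a (two-sided error) `ε`-tester for the property `P` with success probability `p`: it
accepts each function in `P`, and rejects each function `ε`-far from `P`, with probability at
least `p`. -/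
def IsTester {n q : ℕ} (p ε : ℝ) (P : (Cube n → Bool) → Prop)
    (T : PMF (NonAdaptiveAlg n q)) : Prop :=
  (∀ f : Cube n → Bool, P f → p ≤ outputProb T f true) ∧
  (∀ f : Cube n → Bool, FarFrom ε P f → p ≤ outputProb T f false)

/-! By Yao's principle it is enough to find two distributions on functions, one union-closed and one
mostly far from union-closed, that `q` fixed queries rarely tell apart. Both come from `N = 2 ^ k /
8` random gadgets with `K = k + 2 * m` coordinates each. Heavy strings and strings satisfying two
terms get value one. A light string satisfying one term gets value one only if it shows, on the two
blocks, a pattern that is assigned this value. In the yes case a fair coin picks which of the two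
patterns gets it; in the no case the coin gives it to both or to neither.

Yes-functions are union-closed: two points of value one either share gadget and pattern, which the
union preserves, or force a value of one on everything above them. In a no-function, a gadget with
both patterns on is violated at each witness `z`: `z` has value zero but is the union of two points
of value one. Filling the blocks recovers `z` from any of these three points, so the violations are
disjoint and the distance is at least the number of such witnesses
(`sum_card_witnesses_le_hammingDist`). A family has on average at least about `2 ^ (n - 2 * m)`
witnesses, up to a constant, and Chebyshev over the coins finishes farness (`card_not_far_le`).

Each pattern alone has a fair value, so queries help only if two of them, `x` and `y`, show both
patterns of one gadget (`exists_perm_coins`). Then the term lies in `x ∩ y` and both blocks lie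
where `x` and `y` differ. If they differ on a fraction `t`, lightness bounds the fraction of `x ∩ y`
by about `(1 - t) / 2`, so the probability is at most about `2 ^ (-k) * exp (-k t) * t ^ (2 * m)`,
hence `2 ^ (-k) * (2 * m / k) ^ (2 * m)`. A union bound over gadgets and query pairs gives
`IsTester.query_bound`. With `k` near `√n / 2` and `m` of order `log (1 / ε)`, at most `n ^ 0.49`,
the ratio `k / m` is a power of `n`. -/

/-! ### The hard functions -/

/-- The number of ones of a string. -/
def weight {n : ℕ} (x : Cube n) : ℕ := (Finset.univ.filter fun t => x t = true).card

/-- The strings of weight at most `(n + K) / 2`. -/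
def Light {n : ℕ} (K : ℕ) (x : Cube n) : Prop := 2 * weight x ≤ n + K

/-- A gadget: `k` coordinates forming a term, and `2 * m` further coordinates, in two blocks. -/
abbrev Gadget (n k m : ℕ) : Type := (Fin k ⊕ Fin m × Bool) ↪ Fin n

/-- The term of the gadget is satisfied. -/
def Gadget.Active {n k m : ℕ} (e : Gadget n k m) (x : Cube n) : Prop :=
  ∀ a, x (e (Sum.inl a)) = true

/-- On the two blocks of the gadget, `x` is all ones on the block `β` and all zeros on the other. -/
def Gadget.Sees {n k m : ℕ} (e : Gadget n k m) (β : Bool) (x : Cube n) : Prop :=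
  ∀ a b, x (e (Sum.inr (a, b))) = (b == β)

open Classical in
/-- The function given by a family `ω` of gadgets and a choice of values `v` for the two patterns
of each gadget. -/
noncomputable def hardFun {n k m N : ℕ} (ω : Fin N → Gadget n k m) (v : Fin N → Bool → Bool) :
    Cube n → Bool := fun x => decide
  (¬ Light (k + 2 * m) x ∨ (∃ i j, i ≠ j ∧ (ω i).Active x ∧ (ω j).Active x) ∨
    ∃ i β, (ω i).Active x ∧ (ω i).Sees β x ∧ v i β = true)

section
variable {n k m N : ℕ}

theorem hardFun_eq_true {ω : Fin N → Gadget n k m} {v : Fin N → Bool → Bool} {x : Cube n} :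
    hardFun ω v x = true ↔
      ¬ Light (k + 2 * m) x ∨ (∃ i j, i ≠ j ∧ (ω i).Active x ∧ (ω j).Active x) ∨
        ∃ i β, (ω i).Active x ∧ (ω i).Sees β x ∧ v i β = true := by
  simp [hardFun]

theorem weight_mono {x y : Cube n} (h : ∀ t, x t = true → y t = true) : weight x ≤ weight y :=
  Finset.card_le_card fun t ht => by
    simp only [Finset.mem_filter, Finset.mem_univ, true_and] at ht ⊢; exact h t ht

theorem Light.mono {K : ℕ} {x y : Cube n} (h : ∀ t, x t = true → y t = true) (hy : Light K y) :
    Light K x := by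
  have := weight_mono h
  unfold Light at *
  omega

theorem Gadget.Active.mono {e : Gadget n k m} {x y : Cube n} (h : ∀ t, x t = true → y t = true)
    (hx : e.Active x) : e.Active y := fun a => h _ (hx a)

/-- Being heavy and satisfying two terms are both preserved upwards. -/
theorem hardFun_of_le {ω : Fin N → Gadget n k m} {v : Fin N → Bool → Bool} {x y : Cube n}
    (h : ∀ t, x t = true → y t = true)
    (hx : ¬ Light (k + 2 * m) x ∨ ∃ i j, i ≠ j ∧ (ω i).Active x ∧ (ω j).Active x) :
    hardFun ω v y = true := by
  rw [hardFun_eq_true]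
  rcases hx with hx | ⟨i, j, hij, hi, hj⟩
  · exact Or.inl fun hy => hx (hy.mono h)
  · exact Or.inr (Or.inl ⟨i, j, hij, hi.mono h, hj.mono h⟩)

/-- If each gadget has exactly one pattern of value one, the function is union-closed. -/
theorem unionClosed_hardFun (ω : Fin N → Gadget n k m) (c : Fin N → Bool) :
    UnionClosed (hardFun ω fun i β => xor (c i) β) := by
  intro x y hx hy
  have hxz : ∀ t, x t = true → (x.union y) t = true := fun t ht => by simp [Cube.union, ht]
  have hyz : ∀ t, y t = true → (x.union y) t = true := fun t ht => by simp [Cube.union, ht]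
  rw [hardFun_eq_true, ← or_assoc] at hx hy
  rcases hx with hx | ⟨i, β, hai, hsi, hvi⟩
  · exact hardFun_of_le hxz hx
  rcases hy with hy | ⟨j, γ, haj, hsj, hvj⟩
  · exact hardFun_of_le hyz hy
  rw [hardFun_eq_true]
  by_cases hij : i = j
  · subst hij
    have hβγ : β = γ := by
      revert hvi hvj; cases c i <;> cases β <;> cases γ <;> simp
    subst hβγ
    refine Or.inr (Or.inr ⟨i, β, hai.mono hxz, fun a b => ?_, hvi⟩)
    simp [Cube.union, hsi a b, hsj a b]
  · exact Or.inr (Or.inl ⟨i, j, hij, hai.mono hxz, haj.mono hyz⟩)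

/-! ### Witnesses and distance from union-closed functions -/

open Classical in
/-- Light strings that contain all coordinates of the gadget `ω i` and satisfy the term of no
other gadget. -/
noncomputable def witnesses (ω : Fin N → Gadget n k m) (i : Fin N) : Finset (Cube n) :=
  Finset.univ.filter fun z => Light (k + 2 * m) z ∧ (∀ s, z (ω i s) = true) ∧
    ∀ j, j ≠ i → ¬ (ω j).Active z

open Classical in
theorem mem_witnesses {ω : Fin N → Gadget n k m} {i : Fin N} {z : Cube n} :
    z ∈ witnesses ω i ↔ Light (k + 2 * m) z ∧ (∀ s, z (ω i s) = true) ∧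
      ∀ j, j ≠ i → ¬ (ω j).Active z := by
  simp [witnesses]

open Classical in
/-- Set the block `!β` of the gadget to zero. -/
noncomputable def Gadget.clear (e : Gadget n k m) (β : Bool) (z : Cube n) : Cube n :=
  fun t => if ∃ a, t = e (Sum.inr (a, !β)) then false else z t

open Classical in
/-- Set both blocks of the gadget to one. -/
noncomputable def Gadget.fill (e : Gadget n k m) (z : Cube n) : Cube n :=
  fun t => if ∃ s, t = e (Sum.inr s) then true else z t

theorem Gadget.clear_le (e : Gadget n k m) (β : Bool) (z : Cube n) (t : Fin n)
    (h : e.clear β z t = true) : z t = true := by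
  unfold Gadget.clear at h
  split_ifs at h
  exact h

theorem Gadget.clear_union_clear (e : Gadget n k m) (z : Cube n) :
    (e.clear true z).union (e.clear false z) = z := by
  funext t
  unfold Cube.union Gadget.clear
  by_cases h1 : ∃ a, t = e (Sum.inr (a, !true))
  · by_cases h2 : ∃ a, t = e (Sum.inr (a, !false))
    · obtain ⟨a, ha⟩ := h1
      obtain ⟨b, hb⟩ := h2
      have := e.injective (ha.symm.trans hb)
      simp at this
    · rw [if_pos h1, if_neg h2]; simp
  · rw [if_neg h1]
    split_ifs <;> simp

theorem Gadget.active_clear {e : Gadget n k m} {z : Cube n} (hz : ∀ s, z (e s) = true)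
    (β : Bool) : e.Active (e.clear β z) := by
  intro a
  unfold Gadget.clear
  rw [if_neg]
  · exact hz _
  · rintro ⟨b, hb⟩
    simpa using e.injective hb

theorem Gadget.sees_clear {e : Gadget n k m} {z : Cube n} (hz : ∀ s, z (e s) = true)
    (β : Bool) : e.Sees β (e.clear β z) := by
  intro a b
  unfold Gadget.clear
  by_cases hb : b = β
  · rw [if_neg]
    · simp [hz, hb]
    · rintro ⟨a', h⟩
      have := e.injective h
      simp [hb] at this
  · rw [if_pos ⟨a, by rw [Bool.eq_not_of_ne hb]⟩]
    simp [hb]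

theorem Gadget.fill_eq {e : Gadget n k m} {z : Cube n} (hz : ∀ s, z (e s) = true) :
    e.fill z = z := by
  funext t
  unfold Gadget.fill
  split_ifs with h
  · obtain ⟨s, rfl⟩ := h
    exact (hz _).symm
  · rfl

theorem Gadget.fill_clear {e : Gadget n k m} {z : Cube n} (hz : ∀ s, z (e s) = true) (β : Bool) :
    e.fill (e.clear β z) = z := by
  funext t
  unfold Gadget.fill Gadget.clear
  split_ifs with h h'
  · obtain ⟨s, rfl⟩ := h
    exact (hz _).symm
  · obtain ⟨s, hs⟩ := h'
    exact absurd ⟨_, hs⟩ h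
  · rfl

theorem hardFun_witness (hm : 0 < m) {ω : Fin N → Gadget n k m} {v : Fin N → Bool → Bool}
    {i : Fin N} {z : Cube n} (hz : z ∈ witnesses ω i) : hardFun ω v z = false := by
  rw [mem_witnesses] at hz
  obtain ⟨hl, hs, hu⟩ := hz
  rw [← Bool.not_eq_true, hardFun_eq_true]
  rintro (h | ⟨a, b, hab, ha, hb⟩ | ⟨a, β, ha, hsee, -⟩)
  · exact h hl
  · have h1 : a = i := by by_contra h; exact hu a h ha
    have h2 : b = i := by by_contra h; exact hu b h hb
    exact hab (h1.trans h2.symm)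
  · have h1 : a = i := by by_contra h; exact hu a h ha
    subst h1
    -- Both blocks are full at `z`, so it shows no pattern; an empty block (`m = 0`) would spoil
    -- this.
    have := hsee ⟨0, hm⟩ (!β)
    rw [hs] at this
    simp at this

theorem hardFun_clear {ω : Fin N → Gadget n k m} {v : Fin N → Bool → Bool}
    {i : Fin N} {z : Cube n} (hz : z ∈ witnesses ω i) {β : Bool} (hv : v i β = true) :
    hardFun ω v ((ω i).clear β z) = true := by
  rw [mem_witnesses] at hz
  rw [hardFun_eq_true]
  exact Or.inr (Or.inr ⟨i, β, Gadget.active_clear hz.2.1 β, Gadget.sees_clear hz.2.1 β, hv⟩)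

/-- A gadget both of whose patterns have value one forces any union-closed function to disagree
once for each of its witnesses. -/
theorem sum_card_witnesses_le_hammingDist (hm : 0 < m) (ω : Fin N → Gadget n k m)
    (c : Fin N → Bool) {g : Cube n → Bool} (hg : UnionClosed g) :
    ∑ i, (if c i = true then (witnesses ω i).card else 0) ≤
      hammingDist (hardFun ω fun i _ => c i) g := by
  classical
  set f := hardFun ω fun i _ => c i with hf
  -- Disagreements are charged to the only gadget whose term they satisfy, so these sets are
  -- disjoint.
  let D : Fin N → Finset (Cube n) := fun i => Finset.univ.filter fun x =>
    f x ≠ g x ∧ (ω i).Active x ∧ ∀ j, j ≠ i → ¬ (ω j).Active x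
  have hle : ∀ i, (if c i = true then (witnesses ω i).card else 0) ≤ (D i).card := by
    intro i
    split_ifs with hc
    swap; · exact Nat.zero_le _
    refine Finset.card_le_card_of_surjOn ((ω i).fill) ?_
    intro z hz
    have hz' : z ∈ witnesses ω i := hz
    obtain ⟨hl, hs, hu⟩ := mem_witnesses.1 hz'
    by_cases hgz : f z = g z
    · have hcl : ∃ β, g ((ω i).clear β z) = false := by
        by_contra! hcon
        have h := hg _ _ (by simpa using hcon true) (by simpa using hcon false)
        rw [Gadget.clear_union_clear, ← hgz, hf, hardFun_witness hm hz'] at h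
        exact absurd h (by simp)
      obtain ⟨β, hβ⟩ := hcl
      refine ⟨(ω i).clear β z, ?_, Gadget.fill_clear hs β⟩
      simp only [D, Finset.coe_filter, Finset.mem_univ, true_and, Set.mem_ofPred_eq]
      refine ⟨?_, Gadget.active_clear hs β, fun j hj h => hu j hj ?_⟩
      · rw [hβ, hf, hardFun_clear hz' hc]; simp
      · exact h.mono (Gadget.clear_le _ _ _)
    · refine ⟨z, ?_, Gadget.fill_eq hs⟩
      simp only [D, Finset.coe_filter, Finset.mem_univ, true_and, Set.mem_ofPred_eq]
      exact ⟨hgz, fun a => hs _, hu⟩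
  calc _ ≤ ∑ i, (D i).card := Finset.sum_le_sum fun i _ => hle i
    _ = (Finset.univ.biUnion D).card := by
        rw [Finset.card_biUnion]
        intro i _ j _ hij
        rw [Function.onFun, Finset.disjoint_left]
        intro x hx hy
        simp only [D, Finset.mem_filter, Finset.mem_univ, true_and] at hx hy
        exact hy.2.2 i hij hx.2.1
    _ ≤ _ := by
        unfold hammingDist
        refine Finset.card_le_card fun x hx => ?_
        simp only [D, Finset.mem_biUnion, Finset.mem_filter, Finset.mem_univ, true_and] at hx ⊢
        exact hx.choose_spec.1

theorem sum_card_witnesses_le (ω : Fin N → Gadget n k m) :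
    ∑ i, (witnesses ω i).card ≤ 2 ^ n := by
  classical
  rw [← Finset.card_biUnion]
  · refine (Finset.card_le_univ _).trans ?_
    simp
  · intro i _ j _ hij
    rw [Function.onFun, Finset.disjoint_left]
    intro x hx hy
    rw [mem_witnesses] at hx hy
    exact hy.2.2 i hij fun a => hx.2.1 _

/-! ### Indistinguishability -/

/-- Some gadget shows both of its patterns to the queries. -/
def Reveals {q : ℕ} (Q : Fin q → Cube n) (ω : Fin N → Gadget n k m) : Prop :=
  ∃ i r s, Light (k + 2 * m) (Q r) ∧ Light (k + 2 * m) (Q s) ∧ (ω i).Active (Q r) ∧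
    (ω i).Active (Q s) ∧ (ω i).Sees true (Q r) ∧ (ω i).Sees false (Q s)

/-- If no gadget shows both patterns, flipping the coins of the gadgets that show the pattern
`true` turns one kind of function into the other, as far as the queries can see. -/
theorem exists_perm_coins {q : ℕ} {Q : Fin q → Cube n} {ω : Fin N → Gadget n k m}
    (h : ¬ Reveals Q ω) : ∃ σ : Equiv.Perm (Fin N → Bool), ∀ c r,
      hardFun ω (fun i _ => σ c i) (Q r) = hardFun ω (fun i β => xor (c i) β) (Q r) := by
  classical
  let φ : Fin N → Bool := fun i => decide (∃ r, Light (k + 2 * m) (Q r) ∧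
    (ω i).Active (Q r) ∧ (ω i).Sees true (Q r))
  have hφ : Function.Involutive fun (c : Fin N → Bool) i => xor (c i) (φ i) := by
    intro c; funext i; simp
  refine ⟨hφ.toPerm, fun c r => ?_⟩
  rw [Bool.eq_iff_iff, hardFun_eq_true, hardFun_eq_true]
  by_cases hl : Light (k + 2 * m) (Q r)
  swap; · simp [hl]
  refine or_congr Iff.rfl (or_congr Iff.rfl (exists_congr fun i => exists_congr fun β => ?_))
  refine and_congr_right fun ha => and_congr_right fun hs => ?_
  -- Without a revelation the queries see at most one pattern of each gadget, and `φ` names it.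
  have : φ i = β := by
    cases β with
    | true => simp only [φ, decide_eq_true_eq]; exact ⟨r, hl, ha, hs⟩
    | false =>
      simp only [φ, decide_eq_false_iff_not]
      rintro ⟨s, hls, has, hss⟩
      exact h ⟨i, s, r, hls, hl, has, ha, hss, hs⟩
  simp [Function.Involutive.toPerm, this]

end

/-! ### Counting for a single random gadget -/

section
variable {n k m N : ℕ}

theorem card_gadget_slots (k m : ℕ) : Fintype.card (Fin k ⊕ Fin m × Bool) = k + 2 * m := by
  simp [mul_comm]

/-- Injectivity costs at most a factor 2: by Bernoulli, `(1 - K / n) ^ K ≥ 1 - K ^ 2 / n ≥ 1 / 2`.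
So gadget coordinates may be treated as independent. -/
theorem pow_le_two_mul_card_gadget (h : 2 * (k + 2 * m) ^ 2 ≤ n) :
    (n : ℝ) ^ (k + 2 * m) ≤ 2 * Fintype.card (Gadget n k m) := by
  rw [Fintype.card_embedding_eq, card_gadget_slots, Fintype.card_fin]
  set K := k + 2 * m
  rcases Nat.eq_zero_or_pos n with rfl | hn
  · have : K = 0 := by nlinarith
    simp [this]
  have hKn : K ≤ n := by nlinarith
  have h1 : ((n + 1 - K : ℕ) : ℝ) ^ K ≤ (n.descFactorial K : ℝ) := by
    exact_mod_cast Nat.pow_sub_le_descFactorial n K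
  have hn' : (0 : ℝ) < n := by exact_mod_cast hn
  have h2 : (n : ℝ) * (1 + -(K / n : ℝ)) ≤ ((n + 1 - K : ℕ) : ℝ) := by
    rw [Nat.cast_sub (by omega)]
    push_cast
    have : (n : ℝ) * (1 + -(K / n : ℝ)) = n - K := by field_simp; ring
    linarith
  have hK1 : (K : ℝ) / n ≤ 1 := by
    rw [div_le_one hn']; exact_mod_cast hKn
  have h3 := one_add_mul_le_pow (a := -(K / n : ℝ)) (by linarith) K
  have h4 : (K : ℝ) * (K / n) ≤ 1 / 2 := by
    rw [← mul_div_assoc, div_le_iff₀ hn']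
    have : (2 * K ^ 2 : ℝ) ≤ n := by exact_mod_cast h
    nlinarith
  have h5 : ((n : ℝ) * (1 + -(K / n : ℝ))) ^ K ≤ ((n + 1 - K : ℕ) : ℝ) ^ K :=
    pow_le_pow_left₀ (mul_nonneg hn'.le (by linarith)) h2 K
  rw [mul_pow] at h5
  have h6 : (n : ℝ) ^ K * (1 / 2) ≤ (n : ℝ) ^ K * (1 + -(K / n : ℝ)) ^ K :=
    mul_le_mul_of_nonneg_left (by linarith) (by positivity)
  linarith

open Classical in
theorem card_gadget_mem_le (S D : Finset (Fin n)) :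
    (Finset.univ.filter fun e : Gadget n k m =>
      (∀ a, e (Sum.inl a) ∈ S) ∧ ∀ s, e (Sum.inr s) ∈ D).card ≤
      S.card ^ k * D.card ^ (2 * m) := by
  have h : ((Fintype.piFinset fun _ : Fin k => S) ×ˢ
      (Fintype.piFinset fun _ : Fin m × Bool => D)).card = S.card ^ k * D.card ^ (2 * m) := by
    simp [mul_comm]
  rw [← h]
  refine Finset.card_le_card_of_injOn (fun e => (fun a => e (Sum.inl a), fun s => e (Sum.inr s)))
    ?_ ?_
  · intro e he
    simpa using he
  · intro e _ e' _ hee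
    simp only [Prod.mk.injEq] at hee
    ext s
    cases s with
    | inl a => rw [congrFun hee.1 a]
    | inr a => rw [congrFun hee.2 a]

/-- From `1 + s ≤ exp s` with `s = (K - t) / n`; the excess `exp (k * K / n)` is at most `exp (1 /
2) < 2`. It is used with `t = 0` for one string and with `t` the Hamming distance for two. -/
theorem add_pow_le_two_mul_exp {K : ℕ} (hn : 0 < n) (hkK : k ≤ K) (h : 2 * K ^ 2 ≤ n) {x t : ℝ}
    (hx : 0 ≤ x) (hxt : 2 * x ≤ n + K - t) :
    x ^ k ≤ 2 * (n : ℝ) ^ k / 2 ^ k * Real.exp (-(k * (t / n))) := by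
  have hn' : (0 : ℝ) < n := by exact_mod_cast hn
  have h1 : x ≤ (n / 2 : ℝ) * Real.exp (K / n - t / n) := by
    have := Real.add_one_le_exp ((K : ℝ) / n - t / n)
    calc x ≤ (n / 2 : ℝ) * (K / n - t / n + 1) := by field_simp; linarith
      _ ≤ _ := by gcongr
  calc x ^ k ≤ ((n / 2 : ℝ) * Real.exp (K / n - t / n)) ^ k := by gcongr
    _ = (n : ℝ) ^ k / 2 ^ k * (Real.exp (k * (K / n)) * Real.exp (-(k * (t / n)))) := by
        rw [mul_pow, div_pow, ← Real.exp_nat_mul, ← Real.exp_add]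
        ring_nf
    _ ≤ (n : ℝ) ^ k / 2 ^ k * (2 * Real.exp (-(k * (t / n)))) := by
        gcongr
        have h2 : (k : ℝ) * (K / n) ≤ 1 / 2 := by
          rw [← mul_div_assoc, div_le_iff₀ hn']
          have h3 : (2 * K ^ 2 : ℝ) ≤ n := by exact_mod_cast h
          have h4 : (k : ℝ) ≤ K := by exact_mod_cast hkK
          nlinarith
        calc Real.exp (k * (K / n)) ≤ Real.exp (Real.log 2) := by
              gcongr
              linarith [Real.log_two_gt_d9]
          _ = 2 := Real.exp_log (by norm_num)
    _ = _ := by ring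

open Classical in
/-- A light string satisfies the term of a random gadget with probability at most `4 / 2 ^ k`. -/
theorem card_active_le (hn : 0 < n) (h : 2 * (k + 2 * m) ^ 2 ≤ n) {z : Cube n}
    (hz : Light (k + 2 * m) z) :
    ((Finset.univ.filter fun e : Gadget n k m => e.Active z).card : ℝ) ≤
      4 / 2 ^ k * Fintype.card (Gadget n k m) := by
  have h1 := card_gadget_mem_le (k := k) (m := m) (Finset.univ.filter fun t => z t = true)
    Finset.univ
  have h2 : (Finset.univ.filter fun e : Gadget n k m => e.Active z).card ≤
      weight z ^ k * n ^ (2 * m) := by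
    refine (Finset.card_le_card ?_).trans (h1.trans_eq (by simp [weight]))
    intro e he
    have he' := (Finset.mem_filter.1 he).2
    simpa [Gadget.Active] using he'
  have h2' : ((Finset.univ.filter fun e : Gadget n k m => e.Active z).card : ℝ) ≤
      (weight z : ℝ) ^ k * n ^ (2 * m) := by exact_mod_cast h2
  have h3 := add_pow_le_two_mul_exp (k := k) (K := k + 2 * m) (x := weight z) (t := 0) hn
    (by omega) h (by positivity) (by
      have : ((2 * weight z : ℕ) : ℝ) ≤ ((n + (k + 2 * m) : ℕ) : ℝ) := by exact_mod_cast hz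
      push_cast at this ⊢
      linarith)
  have h4 := pow_le_two_mul_card_gadget h
  rw [pow_add] at h4
  simp only [zero_div, mul_zero, neg_zero, Real.exp_zero, mul_one] at h3
  calc _ ≤ (weight z : ℝ) ^ k * n ^ (2 * m) := h2'
    _ ≤ 2 * (n : ℝ) ^ k / 2 ^ k * n ^ (2 * m) := by gcongr
    _ = 2 / 2 ^ k * ((n : ℝ) ^ k * n ^ (2 * m)) := by ring
    _ ≤ 2 / 2 ^ k * (2 * Fintype.card (Gadget n k m)) := by gcongr
    _ = _ := by ring

/-- The maximum is at `t = j / k`; the extra factor `exp (-j)` there is dropped, so `s ≤ exp s` with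
`s = k * t / j` suffices. -/
theorem pow_mul_exp_neg_le {t : ℝ} (ht : 0 ≤ t) (hk : 0 < k) (j : ℕ) :
    t ^ j * Real.exp (-(k * t)) ≤ ((j : ℝ) / k) ^ j := by
  rcases Nat.eq_zero_or_pos j with rfl | hj
  · simp only [pow_zero, one_mul]
    exact Real.exp_le_one_iff.2 (by simp; positivity)
  have hj' : (0 : ℝ) < j := by exact_mod_cast hj
  have hk' : (0 : ℝ) < k := by exact_mod_cast hk
  have h1 : Real.exp (-(k * t)) = Real.exp (-(k * t / j)) ^ j := by
    rw [← Real.exp_nat_mul]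
    congr 1
    field_simp
  rw [h1, ← mul_pow]
  gcongr
  rw [Real.exp_neg, ← div_eq_mul_inv, div_le_iff₀ (Real.exp_pos _)]
  have := Real.add_one_le_exp (k * t / j)
  calc t = j / k * (k * t / j) := by field_simp
    _ ≤ _ := by gcongr; linarith

theorem two_mul_card_inter_add_card_symmDiff (x y : Cube n) :
    2 * (Finset.univ.filter fun t => x t = true ∧ y t = true).card +
      (Finset.univ.filter fun t => x t ≠ y t).card = weight x + weight y := by
  unfold weight
  simp only [Finset.card_filter, Finset.mul_sum, ← Finset.sum_add_distrib]
  refine Finset.sum_congr rfl fun t _ => ?_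
  cases x t <;> cases y t <;> simp

open Classical in
/-- A random gadget shows the pattern `true` at `x` and the pattern `false` at `y` with small
probability. -/
theorem card_reveals_le (hn : 0 < n) (hk : 0 < k) (h : 2 * (k + 2 * m) ^ 2 ≤ n) {x y : Cube n}
    (hx : Light (k + 2 * m) x) (hy : Light (k + 2 * m) y) :
    ((Finset.univ.filter fun e : Gadget n k m => e.Active x ∧ e.Active y ∧ e.Sees true x ∧
      e.Sees false y).card : ℝ) ≤
      4 / 2 ^ k * (((2 * m : ℕ) : ℝ) / k) ^ (2 * m) * Fintype.card (Gadget n k m) := by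
  set I := Finset.univ.filter fun t => x t = true ∧ y t = true
  set D := Finset.univ.filter fun t => x t ≠ y t
  have h1 : (Finset.univ.filter fun e : Gadget n k m => e.Active x ∧ e.Active y ∧ e.Sees true x ∧
      e.Sees false y).card ≤ I.card ^ k * D.card ^ (2 * m) := by
    refine (Finset.card_le_card ?_).trans (card_gadget_mem_le I D)
    intro e he
    simp only [Finset.mem_filter, Finset.mem_univ, true_and, I, D] at he ⊢
    obtain ⟨hax, hay, hsx, hsy⟩ := he
    refine ⟨fun a => ⟨hax a, hay a⟩, fun ⟨a, b⟩ => ?_⟩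
    rw [hsx a b, hsy a b]
    cases b <;> simp
  have h1' : ((Finset.univ.filter fun e : Gadget n k m => e.Active x ∧ e.Active y ∧
      e.Sees true x ∧ e.Sees false y).card : ℝ) ≤ (I.card : ℝ) ^ k * (D.card : ℝ) ^ (2 * m) := by
    exact_mod_cast h1
  have hn' : (0 : ℝ) < n := by exact_mod_cast hn
  have h2 : 2 * I.card + D.card ≤ n + (k + 2 * m) := by
    have : 2 * I.card + D.card = weight x + weight y := by
      convert two_mul_card_inter_add_card_symmDiff x y
    unfold Light at hx hy
    omega
  have h3 := add_pow_le_two_mul_exp (k := k) (K := k + 2 * m) (x := I.card) (t := D.card) hn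
    (by omega) h (by positivity) (by
      have : ((2 * I.card + D.card : ℕ) : ℝ) ≤ ((n + (k + 2 * m) : ℕ) : ℝ) := by exact_mod_cast h2
      push_cast at this ⊢
      linarith)
  have h4 := pow_le_two_mul_card_gadget h
  rw [pow_add] at h4
  have h5 := pow_mul_exp_neg_le (t := (D.card : ℝ) / n) (by positivity) hk (2 * m)
  calc _ ≤ _ := h1'
    _ ≤ 2 * (n : ℝ) ^ k / 2 ^ k * Real.exp (-(k * ((D.card : ℝ) / n))) * (D.card : ℝ) ^ (2 * m) := by
        gcongr
    _ = 2 / 2 ^ k * ((n : ℝ) ^ k * n ^ (2 * m)) *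
        (((D.card : ℝ) / n) ^ (2 * m) * Real.exp (-(k * ((D.card : ℝ) / n)))) := by
        rw [div_pow]; field_simp
    _ ≤ 2 / 2 ^ k * (2 * Fintype.card (Gadget n k m)) * (((2 * m : ℕ) : ℝ) / k) ^ (2 * m) := by
        gcongr
    _ = _ := by ring

open Classical in
theorem card_supersets (e : Gadget n k m) :
    (Finset.univ.filter fun z : Cube n => ∀ s, z (e s) = true).card = 2 ^ (n - (k + 2 * m)) := by
  have h : (Finset.univ.filter fun z : Cube n => ∀ s, z (e s) = true) =
      Fintype.piFinset fun t => if t ∈ Finset.univ.map e then {true} else Finset.univ := by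
    ext z
    simp only [Finset.mem_filter, Finset.mem_univ, true_and, Fintype.mem_piFinset]
    constructor
    · intro hz t
      split_ifs with ht
      · simp only [Finset.mem_map, Finset.mem_univ, true_and] at ht
        obtain ⟨s, rfl⟩ := ht
        simp [hz]
      · simp
    · intro hz s
      have := hz (e s)
      rw [if_pos (by simp)] at this
      simpa using this
  rw [h, Fintype.card_piFinset]
  have : ∀ t : Fin n, (if t ∈ Finset.univ.map e then ({true} : Finset Bool) else Finset.univ).card =
      if t ∈ (Finset.univ.map e)ᶜ then 2 else 1 := by
    intro t
    by_cases ht : t ∈ Finset.univ.map e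
    · rw [if_pos ht, if_neg fun h => Finset.mem_compl.1 h ht]; simp
    · rw [if_neg ht, if_pos (Finset.mem_compl.2 ht)]; simp
  rw [Finset.prod_congr rfl fun t _ => this t, Finset.prod_ite_mem, Finset.univ_inter,
    Finset.prod_const, Finset.card_compl, Finset.card_map, Finset.card_univ, card_gadget_slots,
    Fintype.card_fin]

open Classical in
/-- By reflection, at least half of the strings that contain all coordinates of a gadget are
light. -/
theorem card_supersets_le_light (e : Gadget n k m) :
    2 ^ (n - (k + 2 * m)) ≤ 2 * (Finset.univ.filter fun z : Cube n =>
      Light (k + 2 * m) z ∧ ∀ s, z (e s) = true).card := by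
  set A := Finset.univ.filter fun z : Cube n => ∀ s, z (e s) = true
  have hA : (A.filter fun z => Light (k + 2 * m) z) = Finset.univ.filter fun z : Cube n =>
      Light (k + 2 * m) z ∧ ∀ s, z (e s) = true := by
    ext z; simp [A, and_comm]
  have hsplit := Finset.card_filter_add_card_filter_not (s := A)
    (p := fun z => Light (k + 2 * m) z)
  have hcard : A.card = 2 ^ (n - (k + 2 * m)) := by convert card_supersets e
  rw [← hcard, ← hA]
  suffices hle : (A.filter fun z => ¬ Light (k + 2 * m) z).card ≤
      (A.filter fun z => Light (k + 2 * m) z).card by omega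
  -- Complementing outside the gadget makes the two weights sum to `n + K`, which is why the
  -- threshold for light is `(n + K) / 2`.
  let ρ : Cube n → Cube n := fun z t => if t ∈ Finset.univ.map e then true else !(z t)
  refine Finset.card_le_card_of_injOn ρ ?_ ?_
  · intro z hz
    simp only [Finset.mem_coe, Finset.mem_filter, Finset.mem_univ, true_and, A] at hz ⊢
    refine ⟨fun s => if_pos (Finset.mem_map_of_mem e (Finset.mem_univ s)), ?_⟩
    have hw : weight (ρ z) + weight z = n + (k + 2 * m) := by
      have hc : (Finset.univ.map e).card = k + 2 * m := by
        rw [Finset.card_map, Finset.card_univ, card_gadget_slots]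
      unfold weight
      rw [Finset.card_filter, Finset.card_filter, ← Finset.sum_add_distrib]
      have hpt : ∀ t, ((if ρ z t = true then 1 else 0) + if z t = true then 1 else 0) =
          1 + if t ∈ Finset.univ.map e then 1 else 0 := by
        intro t
        by_cases ht : t ∈ Finset.univ.map e
        · have hρ : ρ z t = true := if_pos ht
          obtain ⟨s, -, rfl⟩ := Finset.mem_map.1 ht
          rw [hρ, hz.1, if_pos ht]
          simp
        · have hρ : ρ z t = !(z t) := if_neg ht
          rw [hρ, if_neg ht]
          cases z t <;> simp
      rw [Finset.sum_congr rfl fun t _ => hpt t, Finset.sum_add_distrib, ← Finset.card_filter,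
        Finset.filter_univ_mem, hc]
      simp
    have h1 := hz.2
    unfold Light at h1 ⊢
    omega
  · intro z hz z' hz' hzz
    simp only [Finset.mem_coe, Finset.mem_filter, Finset.mem_univ, true_and, A] at hz hz'
    funext t
    by_cases ht : t ∈ Finset.univ.map e
    · simp only [Finset.mem_map, Finset.mem_univ, true_and] at ht
      obtain ⟨s, rfl⟩ := ht
      rw [hz.1, hz'.1]
    · have := congrFun hzz t
      simpa only [ρ, if_neg ht, Bool.not_inj_iff] using this

end

/-! ### Averaging over gadget families and coins -/

open Classical in
theorem card_pi_single_coordinate {α : Type*} [Fintype α] {N : ℕ} (i : Fin N) (P Q : α → Prop) :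
    (Finset.univ.filter fun ω : Fin N → α => P (ω i) ∧ ∀ j, j ≠ i → Q (ω j)).card =
      (Finset.univ.filter P).card * (Finset.univ.filter Q).card ^ (N - 1) := by
  have h : (Finset.univ.filter fun ω : Fin N → α => P (ω i) ∧ ∀ j, j ≠ i → Q (ω j)) =
      Fintype.piFinset fun j => if j = i then Finset.univ.filter P else Finset.univ.filter Q := by
    ext ω
    simp only [Finset.mem_filter, Finset.mem_univ, true_and, Fintype.mem_piFinset]
    constructor
    · rintro ⟨h1, h2⟩ j
      split_ifs with hj
      · subst hj; simpa using h1
      · simpa using h2 j hj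
    · intro h
      refine ⟨by simpa using h i, fun j hj => by simpa [hj] using h j⟩
  rw [h, Fintype.card_piFinset, ← Finset.mul_prod_erase _ _ (Finset.mem_univ i), if_pos rfl]
  congr 1
  rw [Finset.prod_congr rfl (g := fun _ => (Finset.univ.filter Q).card)
    fun j hj => by rw [if_neg (Finset.ne_of_mem_erase hj)]]
  simp

/-- Second moment of a linear form in independent uniform signs. -/
theorem sum_sq_signs {N : ℕ} (w : Fin N → ℝ) :
    ∑ c : Fin N → Bool, (∑ i, w i * (if c i = true then 1 else -1)) ^ 2 = 2 ^ N * ∑ i, w i ^ 2 := by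
  let s : Bool → ℝ := fun b => if b = true then 1 else -1
  have horth : ∀ i j, i ≠ j → ∑ c : Fin N → Bool, s (c i) * s (c j) = 0 := by
    intro i j hij
    let τ : (Fin N → Bool) → (Fin N → Bool) := fun c => Function.update c i (!c i)
    have hτ : Function.Involutive τ := by
      intro c; simp [τ]
    have h := Equiv.sum_comp (hτ.toPerm τ) fun c : Fin N → Bool => s (c i) * s (c j)
    have h' : ∀ c, s ((hτ.toPerm τ) c i) * s ((hτ.toPerm τ) c j) = -(s (c i) * s (c j)) := by
      intro c
      have h1 : (hτ.toPerm τ) c i = !c i := by simp [Function.Involutive.toPerm, τ]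
      have h2 : (hτ.toPerm τ) c j = c j := by simp [Function.Involutive.toPerm, τ, hij.symm]
      rw [h1, h2]
      cases c i <;> cases c j <;> simp [s]
    rw [Finset.sum_congr rfl fun c _ => h' c, Finset.sum_neg_distrib] at h
    linarith
  have hdiag : ∀ i, ∑ c : Fin N → Bool, s (c i) * s (c i) = 2 ^ N := by
    intro i
    have : ∀ b, s b * s b = 1 := by intro b; cases b <;> simp [s]
    simp [this]
  calc _ = ∑ c : Fin N → Bool, ∑ i, ∑ j, w i * w j * (s (c i) * s (c j)) := by
        refine Finset.sum_congr rfl fun c _ => ?_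
        rw [sq, Finset.sum_mul_sum]
        refine Finset.sum_congr rfl fun i _ => Finset.sum_congr rfl fun j _ => ?_
        simp only [s]; ring
    _ = ∑ i, ∑ j, w i * w j * ∑ c : Fin N → Bool, s (c i) * s (c j) := by
        rw [Finset.sum_comm]
        refine Finset.sum_congr rfl fun i _ => ?_
        rw [Finset.sum_comm]
        simp only [Finset.mul_sum]
    _ = ∑ i, w i * w i * 2 ^ N := by
        refine Finset.sum_congr rfl fun i _ => ?_
        rw [Finset.sum_eq_single i, hdiag]
        · intro j _ hj
          rw [horth i j hj.symm, mul_zero]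
        · simp
    _ = _ := by
        rw [Finset.mul_sum]
        refine Finset.sum_congr rfl fun i _ => by ring

theorem sum_card_filter_comm {α β : Type*} [Fintype α] [Fintype β] (r : α → β → Prop)
    [∀ a b, Decidable (r a b)] :
    ∑ a, (Finset.univ.filter fun b => r a b).card =
      ∑ b, (Finset.univ.filter fun a => r a b).card := by
  simp only [Finset.card_filter]
  exact Finset.sum_comm

section
variable {n k m N : ℕ}

/-- Exchange the sums and fix `z`. Half is lost to lightness. Each other term holds at a light `z`
with probability at most `4 / 2 ^ k`, so by Bernoulli all of them fail with probability at least `1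
/ 2`. -/
theorem sum_card_witnesses_ge (hn : 0 < n) (h : 2 * (k + 2 * m) ^ 2 ≤ n) (hN : 8 * N ≤ 2 ^ k)
    (i : Fin N) :
    (Fintype.card (Gadget n k m) : ℝ) ^ N * 2 ^ (n - (k + 2 * m)) ≤
      4 * ∑ ω : Fin N → Gadget n k m, ((witnesses ω i).card : ℝ) := by
  classical
  set M : ℝ := (Fintype.card (Gadget n k m) : ℝ) with hM
  have hM0 : 0 ≤ M := by positivity
  have hN1 : 1 ≤ N := i.pos
  have hNr : 8 * (N : ℝ) ≤ 2 ^ k := by exact_mod_cast hN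
  have hk8 : (8 : ℝ) ≤ 2 ^ k := by
    have : (1 : ℝ) ≤ N := by exact_mod_cast hN1
    linarith
  obtain ⟨P, hPdef⟩ : ∃ P : Cube n → Gadget n k m → Prop,
      ∀ z e, P z e ↔ Light (k + 2 * m) z ∧ ∀ s, z (e s) = true := ⟨_, fun _ _ => Iff.rfl⟩
  obtain ⟨R, hRdef⟩ : ∃ R : Cube n → Gadget n k m → Prop,
      ∀ z e, R z e ↔ ¬ e.Active z := ⟨_, fun _ _ => Iff.rfl⟩
  have hcomm : ∑ ω : Fin N → Gadget n k m, (witnesses ω i).card =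
      ∑ z : Cube n, (Finset.univ.filter (P z)).card *
        (Finset.univ.filter (R z)).card ^ (N - 1) := by
    have h1 := sum_card_filter_comm fun (ω : Fin N → Gadget n k m) (z : Cube n) =>
      P z (ω i) ∧ ∀ j, j ≠ i → R z (ω j)
    refine Eq.trans (Finset.sum_congr rfl fun ω _ => congrArg _ ?_)
      (h1.trans (Finset.sum_congr rfl fun z _ => ?_))
    · ext z
      rw [mem_witnesses, Finset.mem_filter]
      simp only [Finset.mem_univ, true_and, hPdef, hRdef, and_assoc]
    · convert card_pi_single_coordinate i (P z) (R z)
  have hR : ∀ z, Light (k + 2 * m) z →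
      M ^ (N - 1) / 2 ≤ ((Finset.univ.filter (R z)).card : ℝ) ^ (N - 1) := by
    intro z hz
    have h1 := card_active_le (k := k) (m := m) hn h hz
    have h2 : ((Finset.univ.filter fun e : Gadget n k m => e.Active z).card : ℝ) +
        (Finset.univ.filter (R z)).card = M := by
      rw [hM, ← Finset.card_univ]
      simp only [hRdef]
      exact_mod_cast Finset.card_filter_add_card_filter_not (s := Finset.univ)
        fun e : Gadget n k m => e.Active z
    have h3 : M * (1 + -(4 / 2 ^ k)) ≤ ((Finset.univ.filter (R z)).card : ℝ) := by
      rw [← hM] at h1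
      linarith
    have h4 : (4 : ℝ) / 2 ^ k ≤ 1 := by
      rw [div_le_one (by positivity)]; linarith
    have h5 := one_add_mul_le_pow (a := -(4 / 2 ^ k : ℝ)) (by linarith) (N - 1)
    have h6 : ((N - 1 : ℕ) : ℝ) * (4 / 2 ^ k) ≤ 1 / 2 := by
      rw [← mul_div_assoc, div_le_iff₀ (by positivity)]
      have : ((N - 1 : ℕ) : ℝ) ≤ N := by exact_mod_cast Nat.sub_le _ _
      linarith
    calc M ^ (N - 1) / 2 = M ^ (N - 1) * (1 / 2) := by ring
      _ ≤ M ^ (N - 1) * (1 + -(4 / 2 ^ k)) ^ (N - 1) := by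
          gcongr
          linarith
      _ = (M * (1 + -(4 / 2 ^ k))) ^ (N - 1) := by rw [mul_pow]
      _ ≤ _ := by
          have : 0 ≤ M * (1 + -(4 / 2 ^ k)) := mul_nonneg hM0 (by linarith)
          gcongr
  have hP : M * 2 ^ (n - (k + 2 * m)) ≤ 2 * ∑ z, ((Finset.univ.filter (P z)).card : ℝ) := by
    have h1 : Fintype.card (Gadget n k m) * 2 ^ (n - (k + 2 * m)) ≤
        2 * ∑ z, (Finset.univ.filter (P z)).card := by
      have h2 : ∑ z, (Finset.univ.filter (P z)).card =
          ∑ e, (Finset.univ.filter fun z => P z e).card := by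
        convert sum_card_filter_comm P
      rw [h2, Finset.mul_sum, ← Finset.card_univ, ← smul_eq_mul, ← Finset.sum_const]
      refine Finset.sum_le_sum fun e _ => ?_
      simp only [hPdef]
      convert card_supersets_le_light e
    rw [hM]
    exact_mod_cast h1
  have hcomm' : ∑ ω : Fin N → Gadget n k m, ((witnesses ω i).card : ℝ) =
      ∑ z : Cube n, ((Finset.univ.filter (P z)).card : ℝ) *
        ((Finset.univ.filter (R z)).card : ℝ) ^ (N - 1) := by exact_mod_cast hcomm
  have hlow : (∑ z, ((Finset.univ.filter (P z)).card : ℝ)) * (M ^ (N - 1) / 2) ≤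
      ∑ ω : Fin N → Gadget n k m, ((witnesses ω i).card : ℝ) := by
    rw [hcomm', Finset.sum_mul]
    refine Finset.sum_le_sum fun z _ => ?_
    by_cases hz : Light (k + 2 * m) z
    · exact mul_le_mul_of_nonneg_left (hR z hz) (Nat.cast_nonneg _)
    · have : Finset.univ.filter (P z) = ∅ := by
        ext e; simp [hPdef, hz]
      simp [this]
  generalize ∑ ω : Fin N → Gadget n k m, ((witnesses ω i).card : ℝ) = Y at hlow ⊢
  generalize ∑ z, ((Finset.univ.filter (P z)).card : ℝ) = X at hlow hP
  have hMN : M ^ N = M ^ (N - 1) * M := by rw [← pow_succ, Nat.sub_add_cancel hN1]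
  have hmul := mul_le_mul_of_nonneg_left hP (pow_nonneg hM0 (N - 1))
  rw [hMN, mul_assoc]
  linarith

open Classical in
/-- A noticeable fraction of the gadget families has many witnesses. -/
theorem card_many_witnesses_ge (hn : 0 < n) (h : 2 * (k + 2 * m) ^ 2 ≤ n) (hN : 8 * N = 2 ^ k) :
    (Fintype.card (Gadget n k m) : ℝ) ^ N ≤ 2 ^ (2 * m + 6) *
      (Finset.univ.filter fun ω : Fin N → Gadget n k m =>
        (2 : ℝ) ^ n ≤ 2 ^ (2 * m + 6) * ∑ i, ((witnesses ω i).card : ℝ)).card := by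
  set M : ℝ := (Fintype.card (Gadget n k m) : ℝ) with hM
  set E := Finset.univ.filter fun ω : Fin N → Gadget n k m =>
        (2 : ℝ) ^ n ≤ 2 ^ (2 * m + 6) * ∑ i, ((witnesses ω i).card : ℝ) with hE
  have hKn : k + 2 * m ≤ n := by nlinarith
  have hNr : 8 * (N : ℝ) = 2 ^ k := by exact_mod_cast hN
  have hlow : N * (M ^ N * 2 ^ (n - (k + 2 * m))) ≤
      4 * ∑ ω : Fin N → Gadget n k m, ∑ i, ((witnesses ω i).card : ℝ) := by
    rw [Finset.sum_comm, Finset.mul_sum]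
    calc _ = ∑ _i : Fin N, M ^ N * 2 ^ (n - (k + 2 * m)) := by simp
      _ ≤ _ := Finset.sum_le_sum fun i _ => sum_card_witnesses_ge hn h hN.le i
  -- Reverse Markov: a family in `E` has at most `2 ^ n` witnesses in total, any other at most `2 ^
  -- n / 2 ^ (2 * m + 6)`.
  have hup : 2 ^ (2 * m + 6) * ∑ ω : Fin N → Gadget n k m, ∑ i, ((witnesses ω i).card : ℝ) ≤
      2 ^ (2 * m + 6) * E.card * 2 ^ n + M ^ N * 2 ^ n := by
    rw [Finset.mul_sum]
    calc _ ≤ ∑ ω : Fin N → Gadget n k m,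
          ((if ω ∈ E then 2 ^ (2 * m + 6) * (2 : ℝ) ^ n else 0) + 2 ^ n) := by
          refine Finset.sum_le_sum fun ω _ => ?_
          by_cases hω : ω ∈ E
          · rw [if_pos hω]
            have h1 : ∑ i, ((witnesses ω i).card : ℝ) ≤ 2 ^ n := by
              exact_mod_cast sum_card_witnesses_le ω
            have : (2 : ℝ) ^ (2 * m + 6) * ∑ i, ((witnesses ω i).card : ℝ) ≤
              2 ^ (2 * m + 6) * 2 ^ n := by gcongr
            have h2 : (0 : ℝ) ≤ 2 ^ n := by positivity
            linarith
          · rw [if_neg hω, zero_add]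
            simp only [hE, Finset.mem_filter, Finset.mem_univ, true_and, not_le] at hω
            exact hω.le
      _ = _ := by
          rw [Finset.sum_add_distrib, Finset.sum_ite_mem, Finset.univ_inter, Finset.sum_const,
            Finset.sum_const, Finset.card_univ, hM]
          simp only [Fintype.card_fun, Fintype.card_fin, nsmul_eq_mul]
          push_cast
          ring
  have hpow : (2 : ℝ) ^ n = 2 ^ (n - (k + 2 * m)) * 2 ^ k * 2 ^ (2 * m) := by
    rw [← pow_add, ← pow_add]; congr 1; omega
  have h6 : (2 : ℝ) ^ (2 * m + 6) = 2 ^ (2 * m) * 64 := by rw [pow_add]; norm_num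
  have h2n : (0 : ℝ) < 2 ^ n := by positivity
  have key : 2 * (M ^ N * 2 ^ n) ≤ 2 ^ (2 * m + 6) * E.card * 2 ^ n + M ^ N * 2 ^ n := by
    refine le_trans ?_ hup
    calc 2 * (M ^ N * 2 ^ n)
        = 2 ^ (2 * m) * 16 * (N * (M ^ N * 2 ^ (n - (k + 2 * m)))) := by
          rw [hpow, ← hNr]; ring
      _ ≤ 2 ^ (2 * m) * 16 *
          (4 * ∑ ω : Fin N → Gadget n k m, ∑ i, ((witnesses ω i).card : ℝ)) := by gcongr
      _ = _ := by rw [h6]; ring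
  have : M ^ N * 2 ^ n ≤ 2 ^ (2 * m + 6) * E.card * 2 ^ n := by linarith
  exact le_of_mul_le_mul_right this h2n

-- Union bound over `N * q ^ 2` triples; the `4 / 2 ^ k` from the terms cancels the number of
-- gadgets.
open Classical in
theorem card_reveals_family_le {q : ℕ} (hn : 0 < n) (hk : 0 < k) (h : 2 * (k + 2 * m) ^ 2 ≤ n)
    (hN : 8 * N ≤ 2 ^ k) (Q : Fin q → Cube n) :
    ((Finset.univ.filter fun ω : Fin N → Gadget n k m => Reveals Q ω).card : ℝ) ≤
      (q : ℝ) ^ 2 * (((2 * m : ℕ) : ℝ) / k) ^ (2 * m) / 2 *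
        (Fintype.card (Gadget n k m) : ℝ) ^ N := by
  set M : ℝ := (Fintype.card (Gadget n k m) : ℝ) with hM
  set b : ℝ := (((2 * m : ℕ) : ℝ) / k) ^ (2 * m) with hb
  have hb0 : 0 ≤ b := by positivity
  obtain ⟨B, hB⟩ : ∃ B : Fin q × Fin q → Gadget n k m → Prop, ∀ rs e, B rs e ↔
      Light (k + 2 * m) (Q rs.1) ∧ Light (k + 2 * m) (Q rs.2) ∧ e.Active (Q rs.1) ∧
      e.Active (Q rs.2) ∧ e.Sees true (Q rs.1) ∧ e.Sees false (Q rs.2) :=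
    ⟨_, fun _ _ => Iff.rfl⟩
  have hsub : (Finset.univ.filter fun ω : Fin N → Gadget n k m => Reveals Q ω) ⊆
      Finset.univ.biUnion fun irs : Fin N × (Fin q × Fin q) =>
        Finset.univ.filter fun ω : Fin N → Gadget n k m =>
          B irs.2 (ω irs.1) ∧ ∀ j, j ≠ irs.1 → True := by
    intro ω hω
    simp only [Finset.mem_filter, Finset.mem_univ, true_and, Finset.mem_biUnion] at hω ⊢
    obtain ⟨i, r, s, hrs⟩ := hω
    exact ⟨(i, r, s), (hB _ _).2 hrs, fun _ _ => trivial⟩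
  have h1 : ∀ irs : Fin N × (Fin q × Fin q),
      ((Finset.univ.filter fun ω : Fin N → Gadget n k m =>
          B irs.2 (ω irs.1) ∧ ∀ j, j ≠ irs.1 → True).card : ℝ) ≤ 4 / 2 ^ k * b * M ^ N := by
    rintro ⟨i, r, s⟩
    have h2 := card_pi_single_coordinate i (B (r, s)) (fun _ => True)
    have h3 : ((Finset.univ.filter (B (r, s))).card : ℝ) ≤ 4 / 2 ^ k * b * M := by
      by_cases hl : Light (k + 2 * m) (Q r) ∧ Light (k + 2 * m) (Q s)
      · refine le_trans ?_ (card_reveals_le hn hk h hl.1 hl.2)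
        exact_mod_cast Finset.card_le_card fun e he => by
          simp only [Finset.mem_filter, Finset.mem_univ, true_and] at he ⊢
          exact ((hB _ _).1 he).2.2
      · have : Finset.univ.filter (B (r, s)) = ∅ := by
          ext e
          simp only [Finset.mem_filter, Finset.mem_univ, true_and, Finset.notMem_empty, iff_false]
          exact fun he => hl ⟨((hB _ _).1 he).1, ((hB _ _).1 he).2.1⟩
        rw [this]
        simp only [Finset.card_empty, Nat.cast_zero]
        positivity
    have h2' : ((Finset.univ.filter fun ω : Fin N → Gadget n k m =>
        B (r, s) (ω i) ∧ ∀ j, j ≠ i → True).card : ℝ) =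
        (Finset.univ.filter (B (r, s))).card * M ^ (N - 1) := by
      rw [Finset.filter_true, Finset.card_univ] at h2
      rw [hM]
      exact_mod_cast h2
    refine h2'.trans_le ?_
    calc _ ≤ 4 / 2 ^ k * b * M * M ^ (N - 1) := by gcongr
      _ = 4 / 2 ^ k * b * (M ^ (N - 1) * M) := by ring
      _ = _ := by rw [← pow_succ, Nat.sub_add_cancel i.pos]
  have hNr : 8 * (N : ℝ) ≤ 2 ^ k := by exact_mod_cast hN
  calc _ ≤ ∑ irs : Fin N × (Fin q × Fin q),
        ((Finset.univ.filter fun ω : Fin N → Gadget n k m =>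
          B irs.2 (ω irs.1) ∧ ∀ j, j ≠ irs.1 → True).card : ℝ) := by
        exact_mod_cast (Finset.card_le_card hsub).trans Finset.card_biUnion_le
    _ ≤ ∑ _irs : Fin N × (Fin q × Fin q), 4 / 2 ^ k * b * M ^ N :=
        Finset.sum_le_sum fun irs _ => h1 irs
    _ = (N * (q * q)) * (4 / 2 ^ k * b * M ^ N) := by simp
    _ = (8 * (N : ℝ)) / 2 ^ k * ((q : ℝ) ^ 2 * b / 2 * M ^ N) := by ring
    _ ≤ 1 * ((q : ℝ) ^ 2 * b / 2 * M ^ N) := by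
        gcongr
        rw [div_le_one (by positivity)]
        exact hNr
    _ = _ := one_mul _

open Classical in
/-- Chebyshev's inequality for a random subsum of nonnegative weights. -/
theorem card_small_subsum_le {w : Fin N → ℝ} {B : ℝ} (hw : ∀ i, 0 ≤ w i) (hB : ∀ i, w i ≤ B)
    (hW : 0 < ∑ i, w i) :
    ((Finset.univ.filter fun c : Fin N → Bool =>
      4 * ∑ i, (if c i = true then w i else 0) < ∑ i, w i).card : ℝ) * ∑ i, w i ≤
      4 * B * 2 ^ N := by
  set W := ∑ i, w i with hWdef
  set F := Finset.univ.filter fun c : Fin N → Bool =>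
      4 * ∑ i, (if c i = true then w i else 0) < W
  -- A subsum below `W / 4` puts the signed sum below `-W / 2`.
  have h1 : (F.card : ℝ) * (W / 2) ^ 2 ≤ 2 ^ N * ∑ i, w i ^ 2 := by
    rw [← sum_sq_signs, ← nsmul_eq_mul, ← Finset.sum_const]
    refine (Finset.sum_le_sum fun c hc => ?_).trans
      (Finset.sum_le_univ_sum_of_nonneg fun c => sq_nonneg _)
    have hc' := (Finset.mem_filter.1 hc).2
    have h2 : ∑ i, w i * (if c i = true then (1 : ℝ) else -1) =
        2 * ∑ i, (if c i = true then w i else 0) - W := by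
      rw [hWdef, Finset.mul_sum, ← Finset.sum_sub_distrib]
      refine Finset.sum_congr rfl fun i _ => ?_
      split_ifs <;> ring
    rw [h2]
    nlinarith
  have h3 : ∑ i, w i ^ 2 ≤ B * W := by
    rw [hWdef, Finset.mul_sum]
    refine Finset.sum_le_sum fun i _ => ?_
    rw [sq]
    exact mul_le_mul_of_nonneg_right (hB i) (hw i)
  have h4 : (F.card : ℝ) * W * W ≤ 4 * B * 2 ^ N * W := by
    have : (2 : ℝ) ^ N * ∑ i, w i ^ 2 ≤ 2 ^ N * (B * W) := by gcongr
    nlinarith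
  exact le_of_mul_le_mul_right h4 hW

theorem card_witnesses_le (ω : Fin N → Gadget n k m) (i : Fin N) :
    (witnesses ω i).card ≤ 2 ^ (n - (k + 2 * m)) := by
  classical
  rw [← card_supersets (ω i)]
  refine Finset.card_le_card fun z hz => ?_
  rw [mem_witnesses] at hz
  simpa using hz.2.1

open Classical in
/-- For a family with many witnesses, most choices of coins give a function far from
union-closed. -/
theorem card_not_far_le (hm : 0 < m) (hKn : k + 2 * m ≤ n) {ω : Fin N → Gadget n k m}
    (hω : (2 : ℝ) ^ n ≤ 2 ^ (2 * m + 6) * ∑ i, ((witnesses ω i).card : ℝ)) {ε : ℝ}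
    (hε : ε * 2 ^ (2 * m + 8) ≤ 1) :
    ((Finset.univ.filter fun c : Fin N → Bool =>
      ¬ FarFrom ε UnionClosed (hardFun ω fun i _ => c i)).card : ℝ) ≤ 2 ^ 8 / 2 ^ k * 2 ^ N := by
  set W := ∑ i, ((witnesses ω i).card : ℝ) with hW
  have h2n : (0 : ℝ) < 2 ^ n := by positivity
  have hW0 : 0 < W := by
    by_contra hcon
    have : (2 : ℝ) ^ (2 * m + 6) * W ≤ 0 :=
      mul_nonpos_of_nonneg_of_nonpos (by positivity) (not_lt.1 hcon)
    linarith
  -- No gadget has more than `2 ^ (n - K)` witnesses, while `W ≥ 2 ^ (n - 2 * m - 6)`; hence the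
  -- failure rate `4 * B / W ≤ 2 ^ 8 / 2 ^ k`.
  have h1 := card_small_subsum_le (w := fun i => ((witnesses ω i).card : ℝ))
    (B := 2 ^ (n - (k + 2 * m))) (fun i => by positivity)
    (fun i => by exact_mod_cast card_witnesses_le ω i) hW0
  rw [← hW] at h1
  set F := Finset.univ.filter fun c : Fin N → Bool =>
      4 * ∑ i, (if c i = true then ((witnesses ω i).card : ℝ) else 0) < W
  have hsub : (Finset.univ.filter fun c : Fin N → Bool =>
      ¬ FarFrom ε UnionClosed (hardFun ω fun i _ => c i)) ⊆ F := by
    intro c hc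
    by_contra hcF
    simp only [F, Finset.mem_filter, Finset.mem_univ, true_and, not_lt] at hc hcF
    refine hc fun g hg => ?_
    have h2 : ∑ i, (if c i = true then ((witnesses ω i).card : ℝ) else 0) ≤
        (hammingDist (hardFun ω fun i _ => c i) g : ℝ) := by
      exact_mod_cast sum_card_witnesses_le_hammingDist hm ω c hg
    unfold boolDist
    rw [le_div_iff₀ h2n]
    have h3 : (2 : ℝ) ^ (2 * m + 8) = 2 ^ (2 * m + 6) * 4 := by
      rw [show 2 * m + 8 = 2 * m + 6 + 2 by ring, pow_add]; norm_num
    have h4 : (2 : ℝ) ^ n ≤ 2 ^ (2 * m + 8) * (hammingDist (hardFun ω fun i _ => c i) g : ℝ) := by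
      rw [h3]
      calc _ ≤ _ := hω
        _ ≤ 2 ^ (2 * m + 6) * (4 * ∑ i, (if c i = true then ((witnesses ω i).card : ℝ) else 0)) := by
            gcongr
        _ ≤ 2 ^ (2 * m + 6) * (4 * (hammingDist (hardFun ω fun i _ => c i) g : ℝ)) := by gcongr
        _ = _ := by ring
    rcases le_or_gt ε 0 with he | he
    · exact (mul_nonpos_of_nonpos_of_nonneg he h2n.le).trans (by positivity)
    calc ε * 2 ^ n ≤ ε * (2 ^ (2 * m + 8) * (hammingDist (hardFun ω fun i _ => c i) g : ℝ)) := by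
          gcongr
      _ = (ε * 2 ^ (2 * m + 8)) * (hammingDist (hardFun ω fun i _ => c i) g : ℝ) := by ring
      _ ≤ 1 * (hammingDist (hardFun ω fun i _ => c i) g : ℝ) := by gcongr
      _ = _ := one_mul _
  have hpow : (2 : ℝ) ^ n = 2 ^ (n - (k + 2 * m)) * 2 ^ k * 2 ^ (2 * m) := by
    rw [← pow_add, ← pow_add]; congr 1; omega
  have hF : (F.card : ℝ) ≤ 2 ^ 8 / 2 ^ k * 2 ^ N := by
    have h5 : (F.card : ℝ) * 2 ^ n ≤ (2 ^ 8 / 2 ^ k * 2 ^ N) * 2 ^ n := by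
      calc (F.card : ℝ) * 2 ^ n ≤ F.card * (2 ^ (2 * m + 6) * W) := by gcongr
        _ = 2 ^ (2 * m + 6) * (F.card * W) := by ring
        _ ≤ 2 ^ (2 * m + 6) * (4 * 2 ^ (n - (k + 2 * m)) * 2 ^ N) := by gcongr
        _ = _ := by rw [hpow, pow_add]; field_simp; norm_num
    exact le_of_mul_le_mul_right h5 h2n
  refine le_trans ?_ hF
  exact_mod_cast Finset.card_le_card hsub

end

/-! ### From deterministic to randomized algorithms -/

/-- A non-adaptive algorithm as a pair of its queries and its verdict. -/
def NonAdaptiveAlg.equivProd (n q : ℕ) :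
    NonAdaptiveAlg n q ≃ (Fin q → Cube n) × ((Fin q → Bool) → Bool) where
  toFun A := (A.query, A.verdict)
  invFun A := ⟨A.1, A.2⟩
  left_inv _ := rfl
  right_inv _ := rfl

noncomputable instance (n q : ℕ) : Fintype (NonAdaptiveAlg n q) :=
  Fintype.ofEquiv _ (NonAdaptiveAlg.equivProd n q).symm

section
variable {n q : ℕ}

theorem outputProb_eq_sum (T : PMF (NonAdaptiveAlg n q)) (f : Cube n → Bool) (b : Bool) :
    outputProb T f b = ∑ A, (T A).toReal * (if A.output f = b then 1 else 0) := by
  classical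
  unfold outputProb
  rw [PMF.map_apply, tsum_fintype, ENNReal.toReal_sum]
  · refine Finset.sum_congr rfl fun A _ => ?_
    by_cases h : A.output f = b
    · simp [h]
    · rw [if_neg fun h' => h h'.symm, if_neg h]; simp
  · intro A _
    split_ifs
    · exact T.apply_ne_top A
    · simp

theorem sum_toReal_pmf (T : PMF (NonAdaptiveAlg n q)) : ∑ A, (T A).toReal = 1 := by
  rw [← ENNReal.toReal_sum fun A _ => T.apply_ne_top A, ← tsum_fintype (L := .unconditional _),
    T.tsum_coe, ENNReal.toReal_one]

theorem outputProb_true_add_false (T : PMF (NonAdaptiveAlg n q)) (f : Cube n → Bool) :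
    outputProb T f true + outputProb T f false = 1 := by
  rw [outputProb_eq_sum, outputProb_eq_sum, ← Finset.sum_add_distrib]
  refine (Finset.sum_congr rfl fun A _ => ?_).trans (sum_toReal_pmf T)
  cases A.output f <;> simp

theorem outputProb_nonneg (T : PMF (NonAdaptiveAlg n q)) (f : Cube n → Bool) (b : Bool) :
    0 ≤ outputProb T f b := ENNReal.toReal_nonneg

/-- If an algorithm accepts the functions `f s` at most `R` more often than the functions `g s`,
whatever its coins, then so it does on average. -/
theorem sum_outputProb_le {ι : Type*} (S : Finset ι) (f g : ι → Cube n → Bool) (R : ℝ)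
    (h : ∀ A : NonAdaptiveAlg n q, ∑ s ∈ S, (if A.output (f s) = true then (1 : ℝ) else 0) ≤
      ∑ s ∈ S, (if A.output (g s) = true then (1 : ℝ) else 0) + R)
    (T : PMF (NonAdaptiveAlg n q)) :
    ∑ s ∈ S, outputProb T (f s) true ≤ ∑ s ∈ S, outputProb T (g s) true + R := by
  simp only [outputProb_eq_sum]
  rw [Finset.sum_comm, Finset.sum_comm (s := S)]
  have hR : R = ∑ A, (T A).toReal * R := by rw [← Finset.sum_mul, sum_toReal_pmf, one_mul]
  rw [hR, ← Finset.sum_add_distrib]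
  refine Finset.sum_le_sum fun A _ => ?_
  rw [← Finset.mul_sum, ← Finset.mul_sum, ← mul_add]
  exact mul_le_mul_of_nonneg_left (h A) ENNReal.toReal_nonneg

theorem IsTester.le_one {p ε : ℝ} {T : PMF (NonAdaptiveAlg n q)}
    (hT : IsTester p ε UnionClosed T) : p ≤ 1 := by
  have h1 := hT.1 (fun _ => false) (by intro x y hx; simp at hx)
  have h2 := outputProb_true_add_false T fun _ => false
  have h3 := outputProb_nonneg T (fun _ => false) false
  linarith

/-- The trade-off between the parameters of the construction and the number of queries. -/
theorem IsTester.query_bound {k m : ℕ} {p ε : ℝ} (hm : 0 < m) (hk : 3 ≤ k)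
    (h : 2 * (k + 2 * m) ^ 2 ≤ n) (hε : ε * 2 ^ (2 * m + 8) ≤ 1)
    {T : PMF (NonAdaptiveAlg n q)} (hT : IsTester p ε UnionClosed T) :
    2 * p - 1 ≤ 2 ^ 8 / 2 ^ k +
      2 ^ (2 * m + 6) * ((q : ℝ) ^ 2 * (((2 * m : ℕ) : ℝ) / k) ^ (2 * m)) := by
  classical
  have hp1 := hT.le_one
  have hn : 0 < n := by
    refine lt_of_lt_of_le ?_ h
    positivity
  have hKn : k + 2 * m ≤ n := by nlinarith
  set N := 2 ^ (k - 3) with hNdef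
  have hN : 8 * N = 2 ^ k := by
    rw [hNdef, show (8 : ℕ) = 2 ^ 3 by norm_num, ← pow_add]; congr 1; omega
  set b : ℝ := (((2 * m : ℕ) : ℝ) / k) ^ (2 * m) with hb
  set M : ℝ := (Fintype.card (Gadget n k m) : ℝ) with hM
  have hM0 : 0 < M := by
    have h1 := pow_le_two_mul_card_gadget h
    have h2 : (0 : ℝ) < (n : ℝ) ^ (k + 2 * m) := by positivity
    linarith
  set E := Finset.univ.filter fun ω : Fin N → Gadget n k m =>
        (2 : ℝ) ^ n ≤ 2 ^ (2 * m + 6) * ∑ i, ((witnesses ω i).card : ℝ) with hE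
  have hEcard : M ^ N ≤ 2 ^ (2 * m + 6) * E.card := card_many_witnesses_ge hn h hN
  have hE0 : (0 : ℝ) < E.card := by
    have : (0 : ℝ) < 2 ^ (2 * m + 6) * E.card := lt_of_lt_of_le (by positivity) hEcard
    exact pos_of_mul_pos_right this (by positivity)
  -- Both cases draw from the same families in `E`. Only density `2 ^ (-(2 * m + 6))` is known for
  -- `E`, so conditioning may inflate the revelation probability by `2 ^ (2 * m + 6)`; the factor
  -- `(2 * m / k) ^ (2 * m)` can pay for this.
  set S : Finset ((Fin N → Gadget n k m) × (Fin N → Bool)) := E ×ˢ Finset.univ with hS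
  have hScard : (S.card : ℝ) = E.card * 2 ^ N := by
    rw [hS, Finset.card_product]; simp
  set R : ℝ := (q : ℝ) ^ 2 * b / 2 * M ^ N * 2 ^ N with hR
  have hcmp := sum_outputProb_le (q := q) S (fun s => hardFun s.1 fun i β => xor (s.2 i) β)
    (fun s => hardFun s.1 fun i _ => s.2 i) R (by
      intro A
      rw [hS, Finset.sum_product, Finset.sum_product]
      -- Unrevealed families give equal acceptance counts by permuting coins; a revealed one costs
      -- at most all `2 ^ N` coins.
      have hstep : ∀ ω ∈ E, ∑ c : Fin N → Bool,
          (if A.output (hardFun ω fun i β => xor (c i) β) = true then (1 : ℝ) else 0) ≤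
          ∑ c : Fin N → Bool, (if A.output (hardFun ω fun i _ => c i) = true then (1 : ℝ) else 0)
            + (if Reveals A.query ω then 2 ^ N else 0) := by
        intro ω _
        by_cases hr : Reveals A.query ω
        · rw [if_pos hr]
          have h1 : ∑ c : Fin N → Bool,
              (if A.output (hardFun ω fun i β => xor (c i) β) = true then (1 : ℝ) else 0) ≤
              ∑ _c : Fin N → Bool, 1 := Finset.sum_le_sum fun c _ => by split_ifs <;> norm_num
          have h2 : 0 ≤ ∑ c : Fin N → Bool,
              (if A.output (hardFun ω fun i _ => c i) = true then (1 : ℝ) else 0) :=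
            Finset.sum_nonneg fun c _ => by split_ifs <;> norm_num
          simp only [Finset.sum_const, Finset.card_univ, Fintype.card_fun, Fintype.card_bool,
            Fintype.card_fin, nsmul_eq_mul, mul_one] at h1
          push_cast at h1
          linarith
        · rw [if_neg hr, add_zero]
          obtain ⟨σ, hσ⟩ := exists_perm_coins hr
          refine le_of_eq ?_
          refine Eq.trans (Finset.sum_congr rfl fun c _ => ?_) (Equiv.sum_comp σ _)
          have : A.output (hardFun ω fun i β => xor (c i) β) =
              A.output (hardFun ω fun i _ => σ c i) := by
            unfold NonAdaptiveAlg.output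
            exact congrArg _ (funext fun r => (hσ c r).symm)
          rw [this]
      refine (Finset.sum_le_sum hstep).trans ?_
      rw [Finset.sum_add_distrib]
      gcongr
      calc ∑ ω ∈ E, (if Reveals A.query ω then (2 : ℝ) ^ N else 0)
          ≤ ∑ ω : Fin N → Gadget n k m, (if Reveals A.query ω then (2 : ℝ) ^ N else 0) :=
            Finset.sum_le_univ_sum_of_nonneg fun ω => by split_ifs <;> positivity
        _ = (Finset.univ.filter fun ω : Fin N → Gadget n k m =>
              Reveals A.query ω).card * 2 ^ N := by
            rw [← Finset.sum_filter, Finset.sum_const, nsmul_eq_mul]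
        _ ≤ _ := by
            rw [hR]
            gcongr
            exact card_reveals_family_le hn (by omega) h hN.le A.query) T
  have hyes : (S.card : ℝ) * p ≤
      ∑ s ∈ S, outputProb T (hardFun s.1 fun i β => xor (s.2 i) β) true := by
    rw [← nsmul_eq_mul]
    exact Finset.card_nsmul_le_sum _ _ _ fun s _ => hT.1 _ (unionClosed_hardFun s.1 s.2)
  have hno : ∑ s ∈ S, outputProb T (hardFun s.1 fun i _ => s.2 i) true ≤
      S.card * (1 - p) + E.card * (2 ^ 8 / 2 ^ k * 2 ^ N) := by
    have hpt : ∀ s ∈ S, outputProb T (hardFun s.1 fun i _ => s.2 i) true ≤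
        (1 - p) + (if ¬ FarFrom ε UnionClosed (hardFun s.1 fun i _ => s.2 i) then 1 else 0) := by
      intro s _
      have h1 := outputProb_true_add_false T (hardFun s.1 fun i _ => s.2 i)
      by_cases hf : FarFrom ε UnionClosed (hardFun s.1 fun i _ => s.2 i)
      · rw [if_neg (not_not.2 hf)]
        have := hT.2 _ hf
        linarith
      · rw [if_pos hf]
        have := outputProb_nonneg T (hardFun s.1 fun i _ => s.2 i) false
        linarith
    refine (Finset.sum_le_sum hpt).trans ?_
    rw [Finset.sum_add_distrib, Finset.sum_const, nsmul_eq_mul, hS, Finset.sum_product]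
    gcongr
    rw [← nsmul_eq_mul]
    refine Finset.sum_le_card_nsmul _ _ _ fun ω hω => ?_
    have h1 := card_not_far_le hm hKn (Finset.mem_filter.1 hω).2 hε
    rw [← Finset.sum_filter, Finset.sum_const, nsmul_eq_mul, mul_one]
    convert h1
  have hR' : R ≤ 2 ^ (2 * m + 6) * ((q : ℝ) ^ 2 * b) * (E.card * 2 ^ N) := by
    have hb0 : 0 ≤ b := by positivity
    calc R ≤ (q : ℝ) ^ 2 * b * M ^ N * 2 ^ N := by
          rw [hR]
          gcongr
          exact half_le_self (by positivity)
      _ ≤ (q : ℝ) ^ 2 * b * (2 ^ (2 * m + 6) * E.card) * 2 ^ N := by gcongr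
      _ = _ := by ring
  rw [hScard] at hyes hno
  have hpos : (0 : ℝ) < E.card * 2 ^ N := by positivity
  refine le_of_mul_le_mul_right ?_ hpos
  nlinarith
end

/-! ### Choice of parameters -/

/-- The hypothesis `hpk` lets the Chebyshev error use at most half of the advantage `2 * p - 1`; the
revelation term must supply the rest. -/
theorem IsTester.sq_queries_ge {n q k m : ℕ} {p ε : ℝ} (hm : 0 < m) (hk : 3 ≤ k)
    (h : 2 * (k + 2 * m) ^ 2 ≤ n) (hε : ε * 2 ^ (2 * m + 8) ≤ 1)
    (hpk : 2 ^ 9 ≤ (2 * p - 1) * 2 ^ k)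
    {T : PMF (NonAdaptiveAlg n q)} (hT : IsTester p ε UnionClosed T) :
    (2 * p - 1) / 2 ^ 7 * ((k : ℝ) / (4 * m)) ^ (2 * m) ≤ (q : ℝ) ^ 2 := by
  have h1 := hT.query_bound hm hk h hε
  have h2 : (2 : ℝ) ^ 8 / 2 ^ k ≤ (2 * p - 1) / 2 := by
    rw [div_le_iff₀ (by positivity)]; linarith
  have hk0 : (0 : ℝ) < k := by exact_mod_cast (by omega : 0 < k)
  have hm0 : (0 : ℝ) < m := by exact_mod_cast hm
  have h3 : ((k : ℝ) / (4 * m)) ^ (2 * m) *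
      (2 ^ (2 * m) * (((2 * m : ℕ) : ℝ) / k) ^ (2 * m)) = 1 := by
    rw [← mul_pow, ← mul_pow]
    have : (k : ℝ) / (4 * m) * (2 * (((2 * m : ℕ) : ℝ) / k)) = 1 := by
      push_cast
      field_simp
      norm_num
    rw [this, one_pow]
  have h4 : (2 * p - 1) / 2 ≤
      2 ^ 6 * (q : ℝ) ^ 2 * (2 ^ (2 * m) * (((2 * m : ℕ) : ℝ) / k) ^ (2 * m)) := by
    rw [pow_add] at h1
    linarith
  set X := ((k : ℝ) / (4 * m)) ^ (2 * m)
  set Y := (2 : ℝ) ^ (2 * m) * (((2 * m : ℕ) : ℝ) / k) ^ (2 * m)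
  have hX : 0 ≤ X := by positivity
  have h5 := mul_le_mul_of_nonneg_right h4 hX
  have h6 : 2 ^ 6 * (q : ℝ) ^ 2 * Y * X = 2 ^ 6 * (q : ℝ) ^ 2 := by
    rw [mul_assoc, mul_comm Y X, h3, mul_one]
  rw [h6] at h5
  linarith

theorem exists_nat_half {L : ℝ} (hL : 33 ≤ L) : ∃ m : ℕ, L / 3 ≤ m ∧ (2 * m + 8 : ℝ) ≤ L := by
  refine ⟨⌊(L - 8) / 2⌋₊, ?_, ?_⟩
  · have := Nat.lt_floor_add_one ((L - 8) / 2)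
    linarith
  · have := Nat.floor_le (show 0 ≤ (L - 8) / 2 by linarith)
    linarith

theorem exists_rpow_ge : ∃ x : ℝ, 1024 ≤ x ∧ 1024 ≤ x ^ (0.005 : ℝ) :=
  ((Filter.eventually_ge_atTop 1024).and
    ((tendsto_rpow_atTop (by norm_num : (0 : ℝ) < 0.005)).eventually_ge_atTop 1024)).exists

theorem theorem1p4 :
    ∀ p : ℝ, 1 / 2 < p →
      ∃ c : ℝ, 0 < c ∧ ∃ κ : ℝ, 0 < κ ∧
        ∀ (n : ℕ) (ε : ℝ), ε < c → (2 : ℝ) ^ (-((n : ℝ) ^ (0.49 : ℝ))) ≤ ε →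
          ∀ (q : ℕ) (T : PMF (NonAdaptiveAlg n q)), IsTester p ε UnionClosed T →
            (n : ℝ) ^ (κ * Real.logb 2 (1 / ε)) ≤ (q : ℝ) := by
  intro p hp
  obtain ⟨j, hj⟩ := pow_unbounded_of_one_lt ((2 : ℝ) ^ 9 / (2 * p - 1)) one_lt_two
  have hγ : 0 < 2 * p - 1 := by linarith
  rw [div_lt_iff₀ hγ] at hj
  obtain ⟨L₁, hbig, hL₁⟩ := exists_rpow_ge
  set L₀ : ℝ := L₁ + 3 * j with hL₀
  have hj0 : (0 : ℝ) ≤ j := by positivity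
  refine ⟨2 ^ (-L₀), by positivity, 1 / 1000, by norm_num, ?_⟩
  intro n ε hεc hεn q T hT
  have hε0 : 0 < ε := lt_of_lt_of_le (by positivity) hεn
  set L := Real.logb 2 (1 / ε) with hL
  have hεL : ε = 2 ^ (-L) := by
    rw [hL, one_div, Real.logb_inv, neg_neg, Real.rpow_logb two_pos (by norm_num) hε0]
  have hLlow : L₀ < L := by
    rw [hεL, Real.rpow_lt_rpow_left_iff one_lt_two] at hεc
    linarith
  have hLup : L ≤ (n : ℝ) ^ (0.49 : ℝ) := by
    rw [hεL, Real.rpow_le_rpow_left_iff one_lt_two] at hεn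
    linarith
  have hn1 : (1 : ℝ) ≤ n := by
    rcases Nat.eq_zero_or_pos n with rfl | h
    · rw [Nat.cast_zero, Real.zero_rpow (by norm_num)] at hLup
      linarith
    · exact_mod_cast h
  have hn0 : (0 : ℝ) < n := by linarith
  have hnbig : L₁ ≤ n := by
    have : (n : ℝ) ^ (0.49 : ℝ) ≤ (n : ℝ) ^ (1 : ℝ) :=
      Real.rpow_le_rpow_of_exponent_le hn1 (by norm_num)
    rw [Real.rpow_one] at this
    linarith
  set u : ℝ := (n : ℝ) ^ (0.005 : ℝ) with hu
  have hu1 : 1024 ≤ u := hL₁.trans (Real.rpow_le_rpow (by linarith) hnbig (by norm_num))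
  have hu0 : 0 < u := by linarith
  -- The gap `0.5 - 0.49 = 2 * 0.005` is what makes `k / m` exceed a power of `n`.
  have hsqrt : √(n : ℝ) = (n : ℝ) ^ (0.49 : ℝ) * u ^ 2 := by
    rw [Real.sqrt_eq_rpow, hu, ← Real.rpow_natCast, ← Real.rpow_mul hn0.le,
      ← Real.rpow_add hn0]
    norm_num
  obtain ⟨m, hm1, hm2⟩ := exists_nat_half (L := L) (by linarith)
  have hm0 : (0 : ℝ) < m := by linarith
  have hm : 0 < m := by exact_mod_cast hm0
  set A := (n : ℝ) ^ (0.49 : ℝ) with hA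
  have hAm : 2 * (m : ℝ) ≤ A := by linarith
  have hA0 : 0 < A := by linarith
  have hu2 : 1024 * u ≤ u ^ 2 := by nlinarith
  have hAu : 1024 * 1024 * A ≤ A * u ^ 2 := by nlinarith
  set k := ⌊√(n : ℝ) / 2⌋₊ with hk
  have hk1 : (k : ℝ) ≤ √(n : ℝ) / 2 := Nat.floor_le (by positivity)
  have hk2 : √(n : ℝ) / 4 ≤ k := by
    have := Nat.lt_floor_add_one (√(n : ℝ) / 2)
    rw [← hk] at this
    rw [hsqrt] at this ⊢
    linarith
  have hkA : A ≤ k := by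
    rw [hsqrt] at hk2
    linarith
  have hk3 : 3 ≤ k := by
    have : (3 : ℝ) ≤ k := by linarith
    exact_mod_cast this
  have hjk : j ≤ k := by
    have : (j : ℝ) ≤ k := by linarith
    exact_mod_cast this
  have hK : 2 * (k + 2 * m) ^ 2 ≤ n := by
    have h1 : (k : ℝ) + 2 * m ≤ 0.6 * √(n : ℝ) := by
      rw [hsqrt] at hk1 ⊢
      linarith
    have h2 : (2 : ℝ) * (k + 2 * m) ^ 2 ≤ n := by
      have h3 : ((k : ℝ) + 2 * m) ^ 2 ≤ (0.6 * √(n : ℝ)) ^ 2 := by gcongr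
      rw [mul_pow, Real.sq_sqrt hn0.le] at h3
      linarith
    exact_mod_cast h2
  have hεm : ε * 2 ^ (2 * m + 8) ≤ 1 := by
    rw [hεL, ← Real.rpow_natCast, ← Real.rpow_add two_pos]
    refine Real.rpow_le_one_of_one_le_of_nonpos one_le_two ?_
    push_cast
    linarith
  have hpk : 2 ^ 9 ≤ (2 * p - 1) * 2 ^ k := by
    have : (2 : ℝ) ^ j ≤ 2 ^ k := pow_le_pow_right₀ one_le_two hjk
    have := mul_le_mul_of_nonneg_left this hγ.le
    linarith
  have hq := hT.sq_queries_ge hm hk3 hK hεm hpk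
  have hratio : 2 * u ≤ (k : ℝ) / (4 * m) := by
    rw [le_div_iff₀ (by positivity)]
    rw [hsqrt] at hk2
    have h1 : A * (1024 * u) ≤ A * u ^ 2 := mul_le_mul_of_nonneg_left hu2 hA0.le
    have h2 : 2 * (m : ℝ) * u ≤ A * u := mul_le_mul_of_nonneg_right hAm hu0.le
    have h3 : 0 < A * u := mul_pos hA0 hu0
    linarith
  have hjm : j ≤ 2 * m := by
    have : (j : ℝ) ≤ ((2 * m : ℕ) : ℝ) := by push_cast; linarith
    exact_mod_cast this
  -- The spare 2 in `2 * u ≤ k / (4 * m)` absorbs the constant depending on `p`.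
  have hγm : 1 ≤ (2 * p - 1) / 2 ^ 7 * 2 ^ (2 * m) := by
    have : (2 : ℝ) ^ j ≤ 2 ^ (2 * m) := pow_le_pow_right₀ one_le_two hjm
    have := mul_le_mul_of_nonneg_left this hγ.le
    linarith
  have hfinal : (u ^ m) ^ 2 ≤ (q : ℝ) ^ 2 := by
    refine le_trans ?_ hq
    calc (u ^ m) ^ 2 = 1 * u ^ (2 * m) := by rw [one_mul, ← pow_mul, mul_comm]
      _ ≤ (2 * p - 1) / 2 ^ 7 * 2 ^ (2 * m) * u ^ (2 * m) := by gcongr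
      _ = (2 * p - 1) / 2 ^ 7 * (2 * u) ^ (2 * m) := by rw [mul_pow]; ring
      _ ≤ _ := by gcongr
  have hum : u ^ m ≤ q := le_of_sq_le_sq hfinal (by positivity)
  refine le_trans ?_ hum
  rw [hu, ← Real.rpow_natCast, ← Real.rpow_mul hn0.le]
  refine Real.rpow_le_rpow_of_exponent_le hn1 ?_
  -- As `m ≥ L / 3`, the exponent `0.005 * m` is at least `L / 600`, above `L / 1000`.
  linarith
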